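/- Let $T_0$ be a finite rooted tree with $n_0\ge 1$ vertices, thought of as the organisational structure of a company: vertices are positions and the root is the position of the boss. A rooted subtree of $T_0$ is a connected set of vertices containing the root. The rooted subtrees are the states of two Markov chains started from $T_0$. In a state $T$ every vertex of $T$ is held by one employee. When an employee is fired, a uniformly chosen employee holding a position that is a strict descendant of the vacated position is promoted to it, the position thereby vacated is filled by the same rule, and so on, until the vacated position has no occupied strict descendants; this last position disappears. No firing occurs when only the boss remains. Write $n=|T|$. Single model: with probability $n/n_0$ one uniformly chosen employee is fired (with the promotion cascade), and with probability $(n_0-n)/n_0$ nothing changes. Binomial model with parameter $q_2\in[0,1]$: the performances of the $n$ employees are independent and uniform on $[0,1]$, and all employees with performance below $1-q_2$ are fired one by one in a uniformly random order (each firing followed by its promotion cascade). For each of the two models let $K(T,U)$ be the probability of moving from $T$ to $U$; a right eigenfunction with eigenvalue $\beta$ is a function $f\neq 0$ on the states with $\sum_U K(T,U)f(U)=\beta f(T)$ for all $T$. Then: (i) The eigenvalues of the single and binomial models are $\frac{j}{n_0}$ and $q_2^{\,n_0-j}$ respectively, for the integers $0\le j\le n_0-2$ and $j=n_0$. (ii)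 The eigenvalue $1$ ($j=n_0$) has multiplicity $1$, and for $0\le j\le n_0-2$ the multiplicity of the eigenvalue indexed by $j$ is the number $N_{n_0-j}$ of rooted subtrees of $T_0$ with $n_0-j$ vertices. That is, with $\beta_j=\frac{j}{n_0}$, respectively $\beta_j=q_2^{\,n_0-j}$, the characteristic polynomial of $K$ is $(x-1)\prod_{j=0}^{n_0-2}(x-\beta_j)^{N_{n_0-j}}$. In the single model, and in the binomial model with $0<q_2<1$, the $\beta_j$ ($0\le j\le n_0-2$) and $1$ are pairwise distinct, and these numbers are the algebraic and the geometric multiplicities of the individual eigenvalues; in the binomial model with $q_2=0$ this still holds for the eigenvalue $1$. (iii) For a rooted subtree $T'$ with $n'\ge 2$ vertices, the function $$f_{T'}(T)=\binom{n}{n'}\,\mathrm{Prob}\left(\text{after firing } n-n' \text{ uniformly chosen employees of } T \text{ (with the promotion cascades), the remaining structure is } T'\right),\qquad n=|T|,$$ (equal to $0$ for $n<n'$) is a right eigenfunction of both chains, with eigenvalue $\frac{n_0-n'}{n_0}$ in the single model and $q_2^{\,n'}$ in the binomial model. The functions $f_{T'}$, together with the constant function $1$ (which has eigenvalue $1$),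 form a basis of the space of real functions on the states. -/

import Mathlib

open MeasureTheory

namespace EmployeeFiring

/-- A rooted subtree of the rooted tree `T₀`: a connected set of vertices containing the root.
The tree order of `T₀` has the root `⊥` at the bottom, `v < w` says that `w` is a strict
descendant of `v`, and the tree as a graph is the Hasse diagram of this order. -/
@[ext]
structure RootedSubtree (T₀ : RootedTree) where
  verts : Finset T₀
  root_mem : ⊥ ∈ verts
  connected : ((SimpleGraph.hasse T₀).induce (verts : Set T₀)).Connected

section

variable {T₀ : RootedTree}

/-- The number of vertices of a rooted subtree. -/
def RootedSubtree.size (T : RootedSubtree T₀) : ℕ := T.verts.card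

theorem RootedSubtree.verts_injective :
    Function.Injective (RootedSubtree.verts : RootedSubtree T₀ → Finset T₀) :=
  fun _ _ h => RootedSubtree.ext h

theorem RootedSubtree.one_le_size (T : RootedSubtree T₀) : 1 ≤ T.size :=
  Finset.card_pos.mpr ⟨⊥, T.root_mem⟩

noncomputable instance [Fintype T₀] : Fintype (RootedSubtree T₀) :=
  Fintype.ofInjective RootedSubtree.verts RootedSubtree.verts_injective

noncomputable instance : DecidableEq (RootedSubtree T₀) := Classical.decEq _

/-- The number of rooted subtrees of `T₀` with `k` vertices. -/
noncomputable def numSubtrees (T₀ : RootedTree) [Fintype T₀] (k : ℕ) : ℕ :=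
  (Finset.univ.filter fun T : RootedSubtree T₀ => T.size = k).card

/-- A snapshot of the company during a month. Employees are named by the position that they hold
at the start of the month; `c e = some v` says that employee `e` currently holds position `v`, and
`c e = none` that there is no such employee (any more). -/
abbrev Company (T₀ : RootedTree) : Type _ := T₀ → Option T₀

/-- The company at the start of a month, with structure `T`. -/
noncomputable def Company.start (T : RootedSubtree T₀) : Company T₀ :=
  open Classical in fun e => if e ∈ T.verts then some e else none

/-- The structure of the company: the set of positions that are held by someone. -/
noncomputable def Company.positions [Fintype T₀] (c : Company T₀) : Finset T₀ :=
  open Classical in Finset.univ.filter fun v => ∃ e, c e = some v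

/-- The number of employees. -/
noncomputable def Company.headcount [Fintype T₀] (c : Company T₀) : ℕ :=
  (Finset.univ.filter fun e => (c e).isSome).card

/-- The employees further down the chain of superiority from position `v`, each paired with the
position that he holds. -/
def Company.Below (c : Company T₀) (v : T₀) : Type _ :=
  {p : T₀ × T₀ // c p.1 = some p.2 ∧ v < p.2}

noncomputable instance [Fintype T₀] (c : Company T₀) (v : T₀) : Fintype (c.Below v) :=
  open Classical in
  inferInstanceAs (Fintype {p : T₀ × T₀ // c p.1 = some p.2 ∧ v < p.2})

/-- The promotion cascade that fills the vacant position `v`: a uniformly chosen employee from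
further down is promoted to `v`, and then his former position is filled in the same way. A vacant
position with nobody further down disappears. -/
noncomputable def Company.promote [Fintype T₀] (c : Company T₀) (v : T₀) : PMF (Company T₀) :=
  open Classical in
  if _h : Nonempty (c.Below v) then
    (PMF.uniformOfFintype (c.Below v)).bind fun p =>
      Company.promote (Function.update c p.1.1 (some v)) p.1.2
  else PMF.pure c
termination_by (open Classical in (Finset.univ.filter fun w => v < w).card)
decreasing_by
  classical
  refine Finset.card_lt_card (Finset.ssubset_iff_of_subset ?_ |>.mpr ⟨p.1.2, ?_, ?_⟩)
  · intro w hw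
    simp only [Finset.mem_filter, Finset.mem_univ, true_and] at hw ⊢
    exact p.2.2.trans hw
  · simpa using p.2.2
  · simp

/-- Employee `e` is fired, with the subsequent promotion cascade. Nobody is fired when only one
employee (the boss) remains. -/
noncomputable def Company.fire [Fintype T₀] (c : Company T₀) (e : T₀) : PMF (Company T₀) :=
  open Classical in
  match c e with
  | none => PMF.pure c
  | some v => if c.headcount ≤ 1 then PMF.pure c
      else Company.promote (Function.update c e none) v

/-- The employees in `S` are fired one by one in a uniformly random order, each firing being
followed by its promotion cascade. -/
noncomputable def Company.fireAll [Fintype T₀] (c : Company T₀) (S : Finset T₀) :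
    PMF (Company T₀) :=
  open Classical in
  if _h : Nonempty S then
    (PMF.uniformOfFintype S).bind fun e =>
      (c.fire e).bind fun c' => Company.fireAll c' (S.erase e)
  else PMF.pure c
termination_by S.card
decreasing_by
  classical
  exact Finset.card_erase_lt_of_mem e.2

/-- The random structure left of `T` after the employees in `S` have been fired. -/
noncomputable def fireSet [Fintype T₀] (T : RootedSubtree T₀) (S : Finset T₀) :
    PMF (Finset T₀) :=
  ((Company.start T).fireAll S).map Company.positions

/-- The random structure left of `T` after `k` uniformly chosen employees have been fired. -/
noncomputable def fireUniform [Fintype T₀] (T : RootedSubtree T₀) (k : ℕ) (hk : k ≤ T.size) :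
    PMF (Finset T₀) :=
  (PMF.uniformOfFinset (T.verts.powersetCard k) (Finset.powersetCard_nonempty.mpr hk)).bind
    fun S => fireSet T S

/-- The transition matrix of the single model; rows are indexed by the source state. -/
noncomputable def singleMatrix (T₀ : RootedTree) [Fintype T₀] :
    Matrix (RootedSubtree T₀) (RootedSubtree T₀) ℝ :=
  Matrix.of fun T U =>
    (T.size : ℝ) / Fintype.card T₀ * (fireUniform T 1 T.one_le_size U.verts).toReal +
      ((Fintype.card T₀ : ℝ) - T.size) / Fintype.card T₀ * (if T = U then 1 else 0)

/-- The probability that exactly the employees in `S` have performance below `1 - q`, if the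
performances of the employees of `T` are independent and uniform on `[0, 1]`. -/
noncomputable def badPerformanceProb (T : RootedSubtree T₀) (q : ℝ) (S : Finset T₀) : ℝ :=
  (volume : Measure (T.verts → unitInterval)).real
    {x | ∀ e : T.verts, (e : T₀) ∈ S ↔ (x e : ℝ) < 1 - q}

/-- The transition matrix of the binomial model with parameter `q`; rows are indexed by the source
state. -/
noncomputable def binomialMatrix (T₀ : RootedTree) [Fintype T₀] (q : ℝ) :
    Matrix (RootedSubtree T₀) (RootedSubtree T₀) ℝ :=
  Matrix.of fun T U =>
    ∑ S ∈ T.verts.powerset, badPerformanceProb T q S * (fireSet T S U.verts).toReal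

/-- The function `f_{T'}`: its value at `T`, with `n` and `n'` the sizes of `T` and `T'`, is
`n.choose n'` times the probability that `T'` is left of `T` after firing `n - n'` uniformly chosen
employees. (For `n < n'` the binomial coefficient is zero.) -/
noncomputable def subtreeFun [Fintype T₀] (T' : RootedSubtree T₀) : RootedSubtree T₀ → ℝ :=
  fun T => (T.size.choose T'.size : ℝ) *
    (fireUniform T (T.size - T'.size) (Nat.sub_le _ _) T'.verts).toReal

end

end EmployeeFiring

/-!
Relabelling the employees of a company does not affect the law of the structure that firings leave
behind. Hence the employees who remain after a uniform firing may be renamed by their new positions,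
and firing `k` uniformly chosen employees has the same effect on the structure as `k` successive
firings of one uniformly chosen employee. In terms of the transition matrix `M` of a single such
firing, the `k` firings have the matrix `M ^ k`, and `f_{T'}(T) = C(n, n') M^(n - n')(T, T')`.

A firing removes one vertex as long as there are two or more. So `f_{T'}`, for `n' ≥ 2`, satisfies
`(M ^ k f_{T'})(T) = C(n - k, n') M^(n - n')(T, T')`, which depends on `k` through the binomial
coefficient only. Both chains mix the powers of `M` with weights that depend on `n` alone, and
`f_{T'}` is an eigenfunction by an identity between binomial coefficients. Ordered by the size of
the subtrees the functions `f_{T'}` are unitriangular. Together with the constant function, which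
takes the place of the one that belongs to the root alone, they form a basis, and both matrices
are diagonal in it.
-/

namespace EmployeeFiring

open scoped BigOperators

section Probability

variable {α β : Type*}

theorem toReal_bind_apply [Fintype α] (p : PMF α) (f : α → PMF β) (b : β) :
    (p.bind f b).toReal = ∑ a, (p a).toReal * (f a b).toReal := by
  rw [PMF.bind_apply, tsum_fintype,
    ENNReal.toReal_sum fun a _ => ENNReal.mul_ne_top (p.apply_ne_top a) ((f a).apply_ne_top b)]
  simp only [ENNReal.toReal_mul]

theorem sum_toReal_apply [Fintype α] (p : PMF α) : ∑ a, (p a).toReal = 1 := by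
  rw [← ENNReal.toReal_sum fun a _ => p.apply_ne_top a, ← tsum_fintype (L := .unconditional _),
    p.tsum_coe, ENNReal.toReal_one]

theorem sum_toReal_apply_mul_congr [Fintype α] {p : PMF α} {f g : α → ℝ}
    (h : ∀ a ∈ p.support, f a = g a) :
    ∑ a, (p a).toReal * f a = ∑ a, (p a).toReal * g a := by
  refine Finset.sum_congr rfl fun a _ => ?_
  by_cases ha : p a = 0
  · rw [ha, ENNReal.toReal_zero, zero_mul, zero_mul]
  · rw [h a ((p.mem_support_iff a).mpr ha)]

theorem toReal_uniformOfFinset_bind_apply (s : Finset α) (hs : s.Nonempty) (f : α → PMF β)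
    (b : β) : ((PMF.uniformOfFinset s hs).bind f b).toReal = 𝔼 a ∈ s, (f a b).toReal := by
  rw [PMF.bind_apply, tsum_eq_sum fun a ha => by
      rw [PMF.uniformOfFinset_apply_of_notMem hs ha, zero_mul],
    Finset.sum_congr rfl fun a ha => by rw [PMF.uniformOfFinset_apply_of_mem hs ha],
    ← Finset.mul_sum, ENNReal.toReal_mul, ENNReal.toReal_sum fun a _ => (f a).apply_ne_top b,
    ENNReal.toReal_inv, ENNReal.toReal_natCast, Finset.expect_eq_sum_div_card, div_eq_inv_mul]

theorem toReal_uniformOfFintype_coe_bind_apply {s : Finset α} [Nonempty s]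
    (f : α → PMF β) (b : β) :
    (((PMF.uniformOfFintype s).bind fun a => f a) b).toReal = 𝔼 a ∈ s, (f a b).toReal := by
  simp only [toReal_bind_apply, PMF.uniformOfFintype_apply, Fintype.card_coe, ENNReal.toReal_inv,
    ENNReal.toReal_natCast]
  rw [Finset.sum_coe_sort s fun a => (s.card : ℝ)⁻¹ * (f a b).toReal, ← Finset.mul_sum,
    Finset.expect_eq_sum_div_card, div_eq_inv_mul]

theorem uniformOfFintype_bind_equiv {γ : Type*} [Fintype α] [Nonempty α] [Fintype β] [Nonempty β]
    (σ : α ≃ β) (f : β → PMF γ) :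
    (PMF.uniformOfFintype β).bind f = (PMF.uniformOfFintype α).bind fun a => f (σ a) := by
  ext x
  simp only [PMF.bind_apply, PMF.uniformOfFintype_apply]
  rw [Fintype.card_congr σ, ← σ.tsum_eq]

end Probability

section Counting

theorem sum_powersetCard_succ_sum_erase {α M : Type*} [DecidableEq α] [AddCommMonoid M]
    (s : Finset α) (k : ℕ) (F : α → Finset α → M) :
    ∑ t ∈ s.powersetCard (k + 1), ∑ a ∈ t, F a (t.erase a) =
      ∑ a ∈ s, ∑ t ∈ (s.erase a).powersetCard k, F a t := by
  rw [Finset.sum_sigma', Finset.sum_sigma']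
  refine Finset.sum_bij' (fun x _ => ⟨x.2, x.1.erase x.2⟩) (fun x _ => ⟨insert x.1 x.2, x.1⟩)
    ?_ ?_ ?_ ?_ fun _ _ => rfl
  all_goals
    simp only [Finset.mem_sigma, Finset.mem_powersetCard, Finset.subset_erase]
    rintro ⟨a, t⟩ h
  · grind
  · grind
  · simp [Finset.insert_erase h.2]
  · simp [Finset.erase_insert h.2.1.2]

theorem expect_powersetCard_succ_expect_erase {α M : Type*} [DecidableEq α] [AddCommMonoid M]
    [Module ℚ≥0 M] (s : Finset α) (k : ℕ) (F : α → Finset α → M) :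
    𝔼 t ∈ s.powersetCard (k + 1), 𝔼 a ∈ t, F a (t.erase a) =
      𝔼 a ∈ s, 𝔼 t ∈ (s.erase a).powersetCard k, F a t := by
  calc 𝔼 t ∈ s.powersetCard (k + 1), 𝔼 a ∈ t, F a (t.erase a)
      = ((s.card.choose (k + 1) : ℚ≥0)⁻¹ * ((k + 1 : ℕ) : ℚ≥0)⁻¹) •
          ∑ t ∈ s.powersetCard (k + 1), ∑ a ∈ t, F a (t.erase a) := by
        rw [Finset.expect, Finset.card_powersetCard, mul_smul,
          Finset.smul_sum (r := ((k + 1 : ℕ) : ℚ≥0)⁻¹)]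
        congr 1
        refine Finset.sum_congr rfl fun t ht => ?_
        rw [Finset.expect, (Finset.mem_powersetCard.mp ht).2]
    _ = ((s.card : ℚ≥0)⁻¹ * ((s.card - 1).choose k : ℚ≥0)⁻¹) •
          ∑ a ∈ s, ∑ t ∈ (s.erase a).powersetCard k, F a t := by
        rw [sum_powersetCard_succ_sum_erase, ← mul_inv, ← mul_inv]
        rcases s.eq_empty_or_nonempty with rfl | hs
        · simp
        · rw [← Nat.cast_mul, ← Nat.cast_mul,
            ← Nat.sub_add_cancel hs.card_pos, Nat.add_sub_cancel, ← Nat.add_one_mul_choose_eq]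
    _ = 𝔼 a ∈ s, 𝔼 t ∈ (s.erase a).powersetCard k, F a t := by
        rw [mul_smul, Finset.smul_sum (r := (((s.card - 1).choose k : ℕ) : ℚ≥0)⁻¹), Finset.expect]
        congr 1
        refine Finset.sum_congr rfl fun a ha => ?_
        rw [Finset.expect, Finset.card_powersetCard, Finset.card_erase_of_mem ha]

theorem sum_pow_mul_pow_mul_choose_mul_choose {R : Type*} [CommSemiring R] (x y : R) (n m : ℕ) :
    ∑ k ∈ Finset.range (n + 1), x ^ k * y ^ (n - k) * n.choose k * (n - k).choose m =
      y ^ m * n.choose m * (x + y) ^ (n - m) := by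
  rcases lt_or_ge n m with h | h
  · rw [Nat.choose_eq_zero_of_lt h, Nat.cast_zero, mul_zero, zero_mul]
    refine Finset.sum_eq_zero fun k _ => ?_
    rw [Nat.choose_eq_zero_of_lt (n := n - k) (by omega), Nat.cast_zero, mul_zero]
  · obtain ⟨l, rfl⟩ := Nat.exists_eq_add_of_le h
    have hterm : ∀ k ∈ Finset.range (l + 1),
        x ^ k * y ^ (m + l - k) * (m + l).choose k * (m + l - k).choose m =
          y ^ m * (m + l).choose m * (x ^ k * y ^ (l - k) * l.choose k) := fun k hk => by
      have hk : k ≤ l := Nat.lt_succ_iff.mp (Finset.mem_range.mp hk)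
      have hchoose : (m + l).choose k * (m + l - k).choose m = (m + l).choose m * l.choose k := by
        rw [← Nat.choose_symm (n := m + l) (by omega), Nat.choose_mul (by omega),
          Nat.add_sub_cancel_left, show m + l - k - m = l - k by omega, Nat.choose_symm hk]
      rw [mul_assoc, ← Nat.cast_mul, hchoose, Nat.add_sub_assoc hk, pow_add, Nat.cast_mul]
      ring
    have htail : ∀ k ∈ Finset.range m,
        x ^ (l + 1 + k) * y ^ (m + l - (l + 1 + k)) * (m + l).choose (l + 1 + k) *
          (m + l - (l + 1 + k)).choose m = 0 := fun k hk => by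
      rw [Finset.mem_range] at hk
      rw [Nat.choose_eq_zero_of_lt (n := m + l - (l + 1 + k)) (by omega), Nat.cast_zero, mul_zero]
    rw [show m + l + 1 = l + 1 + m by omega, Finset.sum_range_add, Finset.sum_eq_zero htail,
      add_zero, Finset.sum_congr rfl hterm, ← Finset.mul_sum, ← add_pow, Nat.add_sub_cancel_left]

end Counting

section Powers

variable {R : Type*} [Semiring R] [LinearOrder R] [IsStrictOrderedRing R] {q : R} {i j n : ℕ}

theorem pow_tsub_eq_one_iff (hq0 : 0 ≤ q) (hq1 : q < 1) (hi : i ≤ n) :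
    q ^ (n - i) = 1 ↔ i = n := by
  refine ⟨fun h => ?_, ?_⟩
  · by_contra hne
    exact (pow_lt_one₀ hq0 hq1 (Nat.sub_ne_zero_of_lt (hi.lt_of_ne hne))).ne h
  · rintro rfl
    rw [Nat.sub_self, pow_zero]

theorem pow_tsub_inj (hq0 : 0 < q) (hq1 : q < 1) (hi : i ≤ n) (hj : j ≤ n) :
    q ^ (n - i) = q ^ (n - j) ↔ i = j := by
  rw [pow_right_inj₀ hq0 hq1.ne, tsub_right_inj hi hj]

end Powers

section Diagonalization

open Polynomial

theorem rootMultiplicity_prod_X_sub_C {ι R : Type*} [Fintype ι] [CommRing R] [IsDomain R]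
    [DecidableEq R] (d : ι → R) (μ : R) :
    (∏ i, (X - C (d i))).rootMultiplicity μ = (Finset.univ.filter fun i => d i = μ).card := by
  have hprod : ∏ i, (X - C (d i)) = ((Finset.univ.val.map d).map fun a => X - C a).prod := by
    rw [Multiset.map_map]; rfl
  rw [← count_roots, hprod, roots_multiset_prod_X_sub_C, Multiset.count_map, Finset.card_def,
    Finset.filter_val]
  simp only [eq_comm]

theorem linearIndependent_of_triangular {ι κ R : Type*} [LinearOrder κ] [WellFoundedLT κ] [Ring R]
    [NoZeroDivisors R] {f : ι → ι → R} (r : ι → κ) (hdiag : ∀ i, f i i ≠ 0)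
    (hoff : ∀ i j, j ≠ i → r i ≤ r j → f j i = 0) : LinearIndependent R f := by
  rw [linearIndependent_iff']
  intro s a ha i
  induction hk : r i using WellFoundedLT.induction generalizing i with
  | ind k ih =>
    intro hi
    have hsum := congrFun ha i
    rw [Finset.sum_apply, Finset.sum_eq_single_of_mem i hi fun j hj hji => ?_] at hsum
    · exact (mul_eq_zero.mp hsum).resolve_right (hdiag i)
    · rcases lt_or_ge (r j) (r i) with hlt | hle
      · rw [ih (r j) (hk ▸ hlt) j rfl hj, zero_smul, Pi.zero_apply]
      · rw [Pi.smul_apply, hoff i j hji hle, smul_zero]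

variable {ι K V : Type*} [Field K] [AddCommGroup V] [Module K V] {f : Module.End K V}
  {b : Module.Basis ι K V} {d : ι → K}

theorem eq_toLin_diagonal [Fintype ι] [DecidableEq ι] (h : ∀ i, f (b i) = d i • b i) :
    f = Matrix.toLin b b (Matrix.diagonal d) :=
  b.ext fun i => by
    rw [h, Matrix.toLin_self, Finset.sum_eq_single i]
    · rw [Matrix.diagonal_apply_eq]
    · intro j _ hj
      rw [Matrix.diagonal_apply_ne _ hj, zero_smul]
    · simp

theorem charpoly_eq_prod_of_apply_basis [Fintype ι] [Module.Finite K V]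
    (h : ∀ i, f (b i) = d i • b i) : f.charpoly = ∏ i, (X - C (d i)) := by
  classical
  rw [eq_toLin_diagonal h, Matrix.charpoly_toLin, Matrix.charpoly_diagonal]

theorem finrank_eigenspace_eq_rootMultiplicity [Finite ι] [Module.Finite K V]
    (h : ∀ i, f (b i) = d i • b i) (μ : K) :
    Module.finrank K (Module.End.eigenspace f μ) = f.charpoly.rootMultiplicity μ := by
  classical
  have := Fintype.ofFinite ι
  rw [← LinearMap.finrank_maxGenEigenspace_eq, eq_toLin_diagonal h,
    Matrix.maxGenEigenspace_toLin_diagonal_eq_eigenspace]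

end Diagonalization

section Subtrees

variable {T₀ : RootedTree}

namespace RootedSubtree

theorem isLowerSet (T : RootedSubtree T₀) : IsLowerSet (T.verts : Set T₀) := by
  intro v w hwv hv
  by_contra hw
  obtain ⟨p⟩ := T.connected.preconnected ⟨v, hv⟩ ⟨⊥, T.root_mem⟩
  have hbot : ¬ w ≤ ⊥ := fun h => hw (le_bot_iff.mp h ▸ T.root_mem)
  obtain ⟨d, -, hd₁, hd₂⟩ := p.exists_boundary_dart {x | w ≤ x} hwv hbot
  rcases d.adj with h | h
  · exact hd₂ (hd₁.trans h.le)
  · have hlt : w < d.fst := hd₁.lt_of_ne fun h => hw (h ▸ d.fst.2)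
    exact hd₂ ((Order.le_pred_of_lt hlt).trans_eq h.pred_eq)

end RootedSubtree

theorem connected_induce_hasse_of_isLowerSet {α : Type*} [PartialOrder α] [OrderBot α]
    [PredOrder α] [WellFoundedLT α] {A : Set α} (hA : IsLowerSet A) (hbot : ⊥ ∈ A) :
    ((SimpleGraph.hasse α).induce A).Connected := by
  have hreach : ∀ v (hv : v ∈ A),
      ((SimpleGraph.hasse α).induce A).Reachable ⟨v, hv⟩ ⟨⊥, hbot⟩ := by
    intro v
    induction v using WellFoundedLT.induction with
    | ind v ih =>
      intro hv
      rcases eq_or_ne v ⊥ with rfl | h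
      · exact SimpleGraph.Reachable.refl _
      · have hcov : Order.pred v ⋖ v := Order.pred_covBy_of_not_isMin (by rwa [isMin_iff_eq_bot])
        have hadj : ((SimpleGraph.hasse α).induce A).Adj ⟨v, hv⟩
            ⟨Order.pred v, hA hcov.le hv⟩ := Or.inr hcov
        exact hadj.reachable.trans (ih _ hcov.lt _)
  have : Nonempty A := ⟨⟨⊥, hbot⟩⟩
  exact ⟨fun v w => (hreach v v.2).trans (hreach w w.2).symm⟩

namespace RootedSubtree

/-- A finite lower set that contains the root, as a rooted subtree. -/
def ofIsLowerSet [Finite T₀] (A : Finset T₀) (hA : IsLowerSet (A : Set T₀)) (hbot : ⊥ ∈ A) :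
    RootedSubtree T₀ :=
  ⟨A, hbot, connected_induce_hasse_of_isLowerSet hA hbot⟩

/-- The subtree that consists of the root alone: the state in which only the boss remains. -/
def single (T₀ : RootedTree) [Finite T₀] : RootedSubtree T₀ :=
  ofIsLowerSet {⊥} (by simpa using isLowerSet_Iic (⊥ : T₀)) (Finset.mem_singleton_self ⊥)

noncomputable instance [Finite T₀] : Inhabited (RootedSubtree T₀) := ⟨single T₀⟩

theorem size_eq_one_iff [Finite T₀] {T : RootedSubtree T₀} : T.size = 1 ↔ T = single T₀ := by
  constructor
  · intro h
    obtain ⟨v, hv⟩ := Finset.card_eq_one.mp h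
    have hroot : ⊥ = v := Finset.mem_singleton.mp (hv ▸ T.root_mem)
    exact RootedSubtree.ext (hv.trans (hroot ▸ rfl))
  · rintro rfl
    rfl

theorem size_le_card [Fintype T₀] (T : RootedSubtree T₀) : T.size ≤ Fintype.card T₀ :=
  Finset.card_le_univ _

end RootedSubtree

end Subtrees

section Companies

open scoped Classical

variable {T₀ : RootedTree}

namespace Company

variable {c : Company T₀} {e v w : T₀}

theorem start_eq_some_iff {T : RootedSubtree T₀} : start T e = some v ↔ e ∈ T.verts ∧ e = v := by
  simp [start]

theorem cascade_induction [Finite T₀] {P : Company T₀ → T₀ → Prop}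
    (step : ∀ c v, (∀ p : Below c v, P (Function.update c p.1.1 (some v)) p.1.2) → P c v)
    (c : Company T₀) (v : T₀) : P c v := by
  induction v using WellFoundedGT.induction generalizing c with
  | ind v ih => exact step c v fun p => ih p.1.2 p.2.2 _

variable [Fintype T₀]

/-- The set of employees of a company, each named by the position held at the start of the
month. -/
def employees (c : Company T₀) : Finset T₀ := Finset.univ.filter fun e => (c e).isSome

/-- A consistent company: no position is held twice, and the superiors of a held position are
held. If somebody is left, the held positions form a rooted subtree. -/
structure Proper (c : Company T₀) : Prop where
  injOn : Set.InjOn c c.employees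
  isLowerSet : IsLowerSet (c.positions : Set T₀)

/-- A company that is consistent apart from the vacancy of position `v`, as it occurs within a
promotion cascade. -/
structure Vacant (c : Company T₀) (v : T₀) : Prop where
  injOn : Set.InjOn c c.employees
  notMem : v ∉ c.positions
  isLowerSet : IsLowerSet (insert v (c.positions : Set T₀))

theorem mem_employees : e ∈ c.employees ↔ ∃ v, c e = some v := by
  rw [employees, Finset.mem_filter_univ, Option.isSome_iff_exists]

theorem mem_positions : v ∈ c.positions ↔ ∃ e, c e = some v :=
  Finset.mem_filter_univ _

theorem card_employees (c : Company T₀) : c.employees.card = c.headcount := rfl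

theorem injOn_employees_iff : Set.InjOn c c.employees ↔
    ∀ ⦃e e' v⦄, c e = some v → c e' = some v → e = e' := by
  constructor
  · exact fun h e e' v he he' =>
      h (mem_employees.mpr ⟨v, he⟩) (mem_employees.mpr ⟨v, he'⟩) (he.trans he'.symm)
  · intro h e he e' _ hee'
    obtain ⟨v, hv⟩ := mem_employees.mp he
    exact h hv (hee' ▸ hv)

theorem employees_start (T : RootedSubtree T₀) : (start T).employees = T.verts := by
  ext e
  simp [mem_employees, start_eq_some_iff]

theorem positions_start (T : RootedSubtree T₀) : (start T).positions = T.verts := by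
  ext v
  simp [mem_positions, start_eq_some_iff]

theorem headcount_start (T : RootedSubtree T₀) : (start T).headcount = T.size := by
  rw [← card_employees, employees_start, RootedSubtree.size]

theorem proper_start (T : RootedSubtree T₀) : (start T).Proper where
  injOn := injOn_employees_iff.mpr fun _ _ _ he he' =>
    (start_eq_some_iff.mp he).2.trans (start_eq_some_iff.mp he').2.symm
  isLowerSet := by
    rw [positions_start]
    exact T.isLowerSet

theorem employees_update (c : Company T₀) (e : T₀) (o : Option T₀) :
    employees (Function.update c e o) =
      if o.isSome then insert e c.employees else c.employees.erase e := by
  ext a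
  by_cases ha : a = e <;> cases o <;> simp [employees, ha]

theorem positions_update (hc : Set.InjOn c c.employees) (he : c e = some w) (o : Option T₀) :
    positions (Function.update c e o) = o.toFinset ∪ c.positions.erase w := by
  ext v
  simp only [mem_positions, Finset.mem_union, Option.mem_toFinset, Option.mem_def,
    Finset.mem_erase]
  constructor
  · rintro ⟨a, ha⟩
    rcases eq_or_ne a e with rfl | hae
    · exact Or.inl (by rwa [Function.update_self] at ha)
    · rw [Function.update_of_ne hae] at ha
      refine Or.inr ⟨?_, a, ha⟩
      rintro rfl
      exact hae (injOn_employees_iff.mp hc ha he)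
  · rintro (ho | ⟨hvw, a, ha⟩)
    · exact ⟨e, by rwa [Function.update_self]⟩
    · have hae : a ≠ e := fun h => hvw (Option.some_injective _ (ha.symm.trans (h ▸ he)))
      exact ⟨a, by rwa [Function.update_of_ne hae]⟩

theorem injOn_update (hc : Set.InjOn c c.employees) (e : T₀) {o : Option T₀}
    (ho : ∀ v ∈ o, v ∉ c.positions) :
    Set.InjOn (Function.update c e o) (employees (Function.update c e o)) := by
  refine injOn_employees_iff.mpr fun a b v ha hb => ?_
  rcases eq_or_ne e a with rfl | hae <;> rcases eq_or_ne e b with rfl | hbe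
  · rfl
  · rw [Function.update_self] at ha
    rw [Function.update_of_ne hbe.symm] at hb
    exact absurd (mem_positions.mpr ⟨b, hb⟩) (ho v ha)
  · rw [Function.update_self] at hb
    rw [Function.update_of_ne hae.symm] at ha
    exact absurd (mem_positions.mpr ⟨a, ha⟩) (ho v hb)
  · rw [Function.update_of_ne hae.symm] at ha
    rw [Function.update_of_ne hbe.symm] at hb
    exact injOn_employees_iff.mp hc ha hb

theorem Vacant.update (hc : c.Vacant v) (he : c e = some w) (hvw : v < w) :
    Vacant (Function.update c e (some v)) w where
  injOn := injOn_update hc.injOn e (by simpa using hc.notMem)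
  notMem := by simp [positions_update hc.injOn he, hvw.ne']
  isLowerSet := by
    have hw : w ∈ c.positions := mem_positions.mpr ⟨e, he⟩
    have hpos : insert w (positions (Function.update c e (some v))) = insert v c.positions := by
      rw [positions_update hc.injOn he, Option.toFinset_some, ← Finset.insert_eq,
        Finset.insert_comm, Finset.insert_erase hw]
    rw [← Finset.coe_insert, hpos, Finset.coe_insert]
    exact hc.isLowerSet

theorem Proper.vacant_update_none (hc : c.Proper) (he : c e = some v) :
    Vacant (Function.update c e none) v where
  injOn := injOn_update hc.injOn e (by simp)
  notMem := by simp [positions_update hc.injOn he]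
  isLowerSet := by
    have hv : v ∈ c.positions := mem_positions.mpr ⟨e, he⟩
    rw [positions_update hc.injOn he, Option.toFinset_none, Finset.empty_union,
      ← Finset.coe_insert, Finset.insert_erase hv]
    exact hc.isLowerSet

theorem Vacant.proper_of_isEmpty (hc : c.Vacant v) (h : IsEmpty (c.Below v)) : c.Proper where
  injOn := hc.injOn
  isLowerSet := by
    have hmax : ∀ w ∈ insert v (c.positions : Set T₀), v ≤ w → w = v := by
      rintro w (rfl | hw) hvw
      · rfl
      · obtain ⟨e, he⟩ := mem_positions.mp hw
        by_contra hne
        exact h.false ⟨(e, w), he, hvw.lt_of_ne' hne⟩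
    simpa [hc.notMem] using hc.isLowerSet.erase hmax

theorem promote_of_nonempty (h : Nonempty (c.Below v)) :
    c.promote v = (PMF.uniformOfFintype (c.Below v)).bind fun p =>
      promote (Function.update c p.1.1 (some v)) p.1.2 := by
  rw [promote, dif_pos h]

theorem promote_of_isEmpty (h : IsEmpty (c.Below v)) : c.promote v = PMF.pure c := by
  rw [promote, dif_neg (not_nonempty_iff.mpr h)]

theorem promote_support_induction {P : Company T₀ → T₀ → Prop} {c' : Company T₀}
    (pure : ∀ v, IsEmpty (Below c' v) → P c' v)
    (step : ∀ c e v w, c e = some w → v < w → P (Function.update c e (some v)) w → P c v)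
    (hc' : c' ∈ (c.promote v).support) : P c v := by
  induction c, v using cascade_induction with
  | step c v ih =>
    rcases isEmpty_or_nonempty (Below c v) with h | h
    · rw [promote_of_isEmpty h, PMF.mem_support_pure_iff] at hc'
      exact hc' ▸ pure v (hc' ▸ h)
    · rw [promote_of_nonempty h, PMF.mem_support_bind_iff] at hc'
      obtain ⟨p, -, hp⟩ := hc'
      exact step c _ v _ p.2.1 p.2.2 (ih p hp)

theorem employees_of_mem_support_promote {c' : Company T₀} (hc' : c' ∈ (c.promote v).support) :
    c'.employees = c.employees := by
  refine promote_support_induction (P := fun c _ => c'.employees = c.employees) (fun _ _ => rfl)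
    (fun c e v w he _ ih => ?_) hc'
  rw [ih, employees_update, if_pos Option.isSome_some,
    Finset.insert_eq_of_mem (mem_employees.mpr ⟨w, he⟩)]

theorem Vacant.proper_of_mem_support_promote (hc : c.Vacant v) {c' : Company T₀}
    (hc' : c' ∈ (c.promote v).support) : c'.Proper :=
  promote_support_induction (P := fun c v => c.Vacant v → c'.Proper)
    (fun _ h hc => hc.proper_of_isEmpty h)
    (fun _ _ _ _ he hvw ih hc => ih (hc.update he hvw)) hc' hc

theorem fire_of_eq_none (he : c e = none) : c.fire e = PMF.pure c := by
  simp only [fire, he]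

theorem fire_of_headcount_le_one (h : c.headcount ≤ 1) (e : T₀) : c.fire e = PMF.pure c := by
  cases he : c e <;> simp only [fire, he, if_pos h]

theorem fire_of_eq_some (h : 1 < c.headcount) (he : c e = some v) :
    c.fire e = promote (Function.update c e none) v := by
  simp only [fire, he, if_neg h.not_ge]

theorem employees_of_mem_support_fire (h : 1 < c.headcount) {c' : Company T₀}
    (hc' : c' ∈ (c.fire e).support) : c'.employees = c.employees.erase e := by
  cases he : c e with
  | none =>
    rw [fire_of_eq_none he, PMF.mem_support_pure_iff] at hc'
    rw [hc', Finset.erase_eq_of_notMem (by simp [mem_employees, he])]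
  | some v =>
    rw [fire_of_eq_some h he] at hc'
    rw [employees_of_mem_support_promote hc', employees_update, if_neg (by simp)]

theorem Proper.of_mem_support_fire (hc : c.Proper) {c' : Company T₀}
    (hc' : c' ∈ (c.fire e).support) : c'.Proper := by
  cases he : c e with
  | none =>
    rw [fire_of_eq_none he, PMF.mem_support_pure_iff] at hc'
    exact hc' ▸ hc
  | some v =>
    rcases le_or_gt c.headcount 1 with h | h
    · rw [fire_of_headcount_le_one h, PMF.mem_support_pure_iff] at hc'
      exact hc' ▸ hc
    · rw [fire_of_eq_some h he] at hc'
      exact (hc.vacant_update_none he).proper_of_mem_support_promote hc'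

end Company
end Companies

section Relabelling

open scoped Classical

variable {T₀ : RootedTree} [Fintype T₀]

namespace Company

variable {c : Company T₀}

/-- The structure of a company as a state of the Markov chains; a junk value if the held positions
do not form a rooted subtree. -/
noncomputable def tree (c : Company T₀) : RootedSubtree T₀ :=
  Function.invFun RootedSubtree.verts c.positions

theorem Proper.verts_tree (hc : c.Proper) (hne : c.employees.Nonempty) :
    c.tree.verts = c.positions := by
  obtain ⟨e, he⟩ := hne
  obtain ⟨v, hv⟩ := mem_employees.mp he
  have hbot : ⊥ ∈ c.positions := hc.isLowerSet bot_le (mem_positions.mpr ⟨e, hv⟩)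
  exact Function.invFun_eq ⟨.ofIsLowerSet c.positions hc.isLowerSet hbot, rfl⟩

theorem Proper.exists_start_tree_eq_comp (hc : c.Proper) (hne : c.employees.Nonempty) :
    ∃ φ : Equiv.Perm T₀, start c.tree = c ∘ φ := by
  have hsome : ∀ e ∈ c.employees, c e = some ((c e).getD ⊥) := fun e he => by
    obtain ⟨v, hv⟩ := mem_employees.mp he
    rw [hv, Option.getD_some]
  have hinj : Set.InjOn (fun e => (c e).getD ⊥) c.employees := fun e he e' he' h =>
    hc.injOn he he' <| by rw [hsome e he, hsome e' he']; exact congrArg some h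
  obtain ⟨g, hg⟩ := Finset.exists_equiv_extend_of_card_eq (Finset.card_univ (α := T₀)).symm
    (Finset.subset_univ _) hinj
  let φ : Equiv.Perm T₀ := g.trans (Equiv.subtypeUnivEquiv Finset.mem_univ)
  have hφ : ∀ e ∈ c.employees, c e = some (φ e) := fun e he =>
    (hsome e he).trans (congrArg some (hg e he).symm)
  refine ⟨φ.symm, (Equiv.eq_comp_symm φ _ _).mpr (funext fun e => ?_)⟩
  rw [Function.comp_apply, start, hc.verts_tree hne]
  by_cases he : e ∈ c.employees
  · rw [if_pos (mem_positions.mpr ⟨e, hφ e he⟩), hφ e he]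
  · have hpos : φ e ∉ c.positions := fun h => by
      obtain ⟨e', he'⟩ := mem_positions.mp h
      have hmem : e' ∈ c.employees := mem_employees.mpr ⟨_, he'⟩
      have heq : e = e' := φ.injective (Option.some_injective _ (he'.symm.trans (hφ e' hmem)))
      exact he (heq ▸ hmem)
    rw [if_neg hpos]
    exact (by simpa [employees] using he : c e = none).symm

theorem positions_comp (c : Company T₀) (φ : Equiv.Perm T₀) : positions (c ∘ φ) = c.positions := by
  ext v
  rw [mem_positions, mem_positions]
  exact (φ.surjective.exists (p := fun e => c e = some v)).symm

theorem employees_comp (c : Company T₀) (φ : Equiv.Perm T₀) :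
    (employees (c ∘ φ)).map φ.toEmbedding = c.employees := by
  ext e
  simp [mem_employees, Finset.mem_map_equiv]

theorem headcount_comp (c : Company T₀) (φ : Equiv.Perm T₀) :
    headcount (c ∘ φ) = c.headcount := by
  rw [← card_employees, ← card_employees, ← employees_comp c φ, Finset.card_map]

theorem promote_comp (c : Company T₀) (φ : Equiv.Perm T₀) (v : T₀) :
    promote (c ∘ φ) v = (c.promote v).map (· ∘ φ) := by
  induction c, v using cascade_induction with
  | step c v ih =>
    let σ : Below (c ∘ φ) v ≃ Below c v :=
      (φ.prodCongr (Equiv.refl T₀)).subtypeEquiv fun _ => Iff.rfl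
    rcases isEmpty_or_nonempty (Below c v) with h | h
    · rw [promote_of_isEmpty h, promote_of_isEmpty σ.isEmpty, PMF.pure_map]
    · have h' : Nonempty (Below (c ∘ φ) v) := σ.nonempty
      rw [promote_of_nonempty h, promote_of_nonempty h', PMF.map_bind,
        uniformOfFintype_bind_equiv σ]
      congr 1
      funext p
      rw [← ih (σ p)]
      exact congrArg (promote · _) (Function.update_comp_eq_of_injective c φ.injective _ _).symm

theorem fire_comp (c : Company T₀) (φ : Equiv.Perm T₀) (e : T₀) :
    fire (c ∘ φ) e = (c.fire (φ e)).map (· ∘ φ) := by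
  rcases le_or_gt c.headcount 1 with h | h
  · rw [fire_of_headcount_le_one h,
      fire_of_headcount_le_one ((headcount_comp c φ).trans_le h), PMF.pure_map]
  · cases he : c (φ e) with
    | none => rw [fire_of_eq_none he, fire_of_eq_none (c := c ∘ φ) he, PMF.pure_map]
    | some v =>
      rw [fire_of_eq_some h he, fire_of_eq_some (h.trans_eq (headcount_comp c φ).symm) he,
        ← promote_comp, Function.update_comp_eq_of_injective c φ.injective]

theorem fireAll_empty (c : Company T₀) : c.fireAll ∅ = PMF.pure c := by
  rw [fireAll, dif_neg (by simp)]

theorem fireAll_of_nonempty (c : Company T₀) {S : Finset T₀} (hS : Nonempty S) :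
    c.fireAll S = (PMF.uniformOfFintype S).bind fun e =>
      (c.fire e).bind fun c' => c'.fireAll (S.erase e) := by
  rw [fireAll, dif_pos hS]

theorem fireAll_comp (c : Company T₀) (φ : Equiv.Perm T₀) (S : Finset T₀) :
    fireAll (c ∘ φ) S = (c.fireAll (S.map φ.toEmbedding)).map (· ∘ φ) := by
  induction S using Finset.strongInduction generalizing c with
  | H S ih =>
    rcases S.eq_empty_or_nonempty with rfl | hS
    · rw [Finset.map_empty, fireAll_empty, fireAll_empty, PMF.pure_map]
    · have := hS.to_subtype
      have := (hS.map (f := φ.toEmbedding)).to_subtype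
      rw [fireAll_of_nonempty _ ‹_›, fireAll_of_nonempty _ ‹_›, PMF.map_bind,
        uniformOfFintype_bind_equiv (φ.subtypeEquiv fun _ => (Finset.mem_map' φ.toEmbedding).symm)]
      congr 1
      funext e
      rw [fire_comp, PMF.bind_map, PMF.map_bind]
      congr 1
      funext c'
      rw [Function.comp_apply, ih _ (Finset.erase_ssubset e.2), Finset.map_erase]
      rfl

end Company
end Relabelling

section Firings

open scoped Classical

variable {T₀ : RootedTree} [Fintype T₀]

namespace Company

variable {c : Company T₀} {k : ℕ}

/-- The probability that precisely the positions in `A` are left after `k` uniformly chosen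
employees have been fired. -/
noncomputable def remainProb (c : Company T₀) (k : ℕ) (A : Finset T₀) : ℝ :=
  𝔼 S ∈ c.employees.powersetCard k, ((c.fireAll S).map positions A).toReal

theorem remainProb_zero (c : Company T₀) (A : Finset T₀) :
    c.remainProb 0 A = if A = c.positions then 1 else 0 := by
  rw [remainProb, Finset.powersetCard_zero, Finset.expect_singleton, fireAll_empty, PMF.pure_map,
    PMF.pure_apply]
  split_ifs <;> rfl

theorem remainProb_comp (c : Company T₀) (φ : Equiv.Perm T₀) (k : ℕ) (A : Finset T₀) :
    remainProb (c ∘ φ) k A = c.remainProb k A := by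
  have hcomp : positions ∘ (fun c' : Company T₀ => c' ∘ φ) = positions :=
    funext fun c' => positions_comp c' φ
  have hmap : ∀ S, (fireAll (c ∘ φ) S).map positions =
      (c.fireAll (S.map φ.toEmbedding)).map positions := fun S => by
    rw [fireAll_comp, PMF.map_comp, hcomp]
  simp only [remainProb, Finset.expect, hmap, ← employees_comp c φ, Finset.powersetCard_map,
    Finset.sum_map, Finset.card_map, Finset.mapEmbedding_apply, RelEmbedding.coe_toEmbedding]

theorem toReal_map_positions_fireAll (c : Company T₀) {S : Finset T₀} (hS : S.Nonempty)
    (A : Finset T₀) :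
    ((c.fireAll S).map positions A).toReal = 𝔼 e ∈ S, ∑ c', (c.fire e c').toReal *
      ((c'.fireAll (S.erase e)).map positions A).toReal := by
  have := hS.to_subtype
  rw [fireAll_of_nonempty c this, PMF.map_bind,
    toReal_uniformOfFintype_coe_bind_apply fun e =>
      ((c.fire e).bind fun c' => c'.fireAll (S.erase e)).map positions]
  simp only [PMF.map_bind, toReal_bind_apply]

theorem powersetCard_employees_of_mem_support_fire (hk : k < c.headcount) {e : T₀}
    {c' : Company T₀} (hc' : c' ∈ (c.fire e).support) :
    c'.employees.powersetCard k = (c.employees.erase e).powersetCard k := by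
  rcases k.eq_zero_or_pos with rfl | hpos
  · rw [Finset.powersetCard_zero, Finset.powersetCard_zero]
  · rw [employees_of_mem_support_fire (Nat.lt_of_le_of_lt hpos hk) hc']

theorem remainProb_succ (hk : k < c.headcount) (A : Finset T₀) :
    c.remainProb (k + 1) A =
      𝔼 e ∈ c.employees, ∑ c', (c.fire e c').toReal * c'.remainProb k A := by
  calc c.remainProb (k + 1) A
      = 𝔼 S ∈ c.employees.powersetCard (k + 1), 𝔼 e ∈ S, ∑ c', (c.fire e c').toReal *
          ((c'.fireAll (S.erase e)).map positions A).toReal :=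
        Finset.expect_congr rfl fun S hS => c.toReal_map_positions_fireAll
          (Finset.card_pos.mp <| (Finset.mem_powersetCard.mp hS).2 ▸ k.succ_pos) A
    _ = 𝔼 e ∈ c.employees, 𝔼 S ∈ (c.employees.erase e).powersetCard k,
          ∑ c', (c.fire e c').toReal * ((c'.fireAll S).map positions A).toReal :=
        expect_powersetCard_succ_expect_erase _ k fun e S =>
          ∑ c', (c.fire e c').toReal * ((c'.fireAll S).map positions A).toReal
    _ = 𝔼 e ∈ c.employees, ∑ c', (c.fire e c').toReal * c'.remainProb k A :=
        Finset.expect_congr rfl fun e _ => by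
          rw [Finset.expect_sum_comm]
          simp only [← Finset.mul_expect]
          exact sum_toReal_apply_mul_congr fun c' hc' => by
            rw [remainProb, powersetCard_employees_of_mem_support_fire hk hc']

theorem employees_nonempty_of_mem_support_fire_start {T : RootedSubtree T₀} {e : T₀}
    (hc : c ∈ ((start T).fire e).support) : c.employees.Nonempty := by
  rcases le_or_gt (start T).headcount 1 with h | h
  · rw [fire_of_headcount_le_one h, PMF.mem_support_pure_iff] at hc
    rw [hc, employees_start]
    exact ⟨⊥, T.root_mem⟩
  · rw [employees_of_mem_support_fire h hc]
    exact Finset.Nontrivial.erase_nonempty (Finset.one_lt_card_iff_nontrivial.mp h)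

theorem exists_start_tree_eq_comp_of_mem_support_fire {T : RootedSubtree T₀} {e : T₀}
    (hc : c ∈ ((start T).fire e).support) : ∃ φ : Equiv.Perm T₀, start c.tree = c ∘ φ :=
  ((proper_start T).of_mem_support_fire hc).exists_start_tree_eq_comp
    (employees_nonempty_of_mem_support_fire_start hc)

theorem size_tree_of_mem_support_fire {T : RootedSubtree T₀} {e : T₀} (he : e ∈ T.verts)
    (hc : c ∈ ((start T).fire e).support) : c.tree.size = max (T.size - 1) 1 := by
  obtain ⟨φ, hφ⟩ := exists_start_tree_eq_comp_of_mem_support_fire hc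
  have hsize : c.headcount = c.tree.size := by
    rw [← headcount_start, hφ, headcount_comp]
  rw [← hsize]
  rcases le_or_gt T.size 1 with h | h
  · rw [fire_of_headcount_le_one ((headcount_start T).trans_le h), PMF.mem_support_pure_iff] at hc
    rw [hc, headcount_start]
    have := T.one_le_size
    omega
  · rw [← card_employees, employees_of_mem_support_fire (h.trans_eq (headcount_start T).symm) hc,
      employees_start, Finset.card_erase_of_mem he]
    exact (max_eq_left (Nat.le_sub_one_of_lt h)).symm

end Company

theorem toReal_fireUniform_apply (T : RootedSubtree T₀) (k : ℕ) (hk : k ≤ T.size)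
    (A : Finset T₀) : (fireUniform T k hk A).toReal = (Company.start T).remainProb k A := by
  rw [fireUniform, toReal_uniformOfFinset_bind_apply, Company.remainProb, Company.employees_start]
  rfl

/-- The transition matrix of the chain that fires one uniformly chosen employee in each step. -/
noncomputable def fireMatrix (T₀ : RootedTree) [Fintype T₀] :
    Matrix (RootedSubtree T₀) (RootedSubtree T₀) ℝ :=
  Matrix.of fun T U => (fireUniform T 1 T.one_le_size U.verts).toReal

open Matrix

theorem fireMatrix_apply (T U : RootedSubtree T₀) :
    fireMatrix T₀ T U = 𝔼 e ∈ T.verts, ∑ c, ((Company.start T).fire e c).toReal *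
      if c.tree = U then 1 else 0 := by
  rw [fireMatrix, Matrix.of_apply, toReal_fireUniform_apply, Company.remainProb_succ
    (T.one_le_size.trans_eq (Company.headcount_start T).symm), Company.employees_start]
  refine Finset.expect_congr rfl fun e _ => sum_toReal_apply_mul_congr fun c hc => ?_
  obtain ⟨φ, hφ⟩ := Company.exists_start_tree_eq_comp_of_mem_support_fire hc
  have hpos : c.positions = c.tree.verts := by
    rw [← Company.positions_start c.tree, hφ, Company.positions_comp]
  simp only [Company.remainProb_zero, hpos, RootedSubtree.verts_injective.eq_iff, eq_comm]

theorem fireMatrix_mulVec_apply (g : RootedSubtree T₀ → ℝ) (T : RootedSubtree T₀) :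
    (fireMatrix T₀ *ᵥ g) T =
      𝔼 e ∈ T.verts, ∑ c, ((Company.start T).fire e c).toReal * g c.tree := by
  simp only [Matrix.mulVec, dotProduct, fireMatrix_apply, Finset.expect_mul]
  rw [← Finset.expect_sum_comm]
  refine Finset.expect_congr rfl fun e _ => ?_
  simp only [Finset.sum_mul]
  rw [Finset.sum_comm]
  simp

theorem fireMatrix_mulVec_one : fireMatrix T₀ *ᵥ 1 = 1 := by
  funext T
  simp only [fireMatrix_mulVec_apply, Pi.one_apply, mul_one, sum_toReal_apply]
  exact Finset.expect_const ⟨⊥, T.root_mem⟩ 1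

theorem fireMatrix_mulVec_congr {T : RootedSubtree T₀} {f g : RootedSubtree T₀ → ℝ}
    (h : ∀ U, U.size = max (T.size - 1) 1 → f U = g U) :
    (fireMatrix T₀ *ᵥ f) T = (fireMatrix T₀ *ᵥ g) T := by
  rw [fireMatrix_mulVec_apply, fireMatrix_mulVec_apply]
  exact Finset.expect_congr rfl fun e he => sum_toReal_apply_mul_congr fun c hc =>
    h _ (Company.size_tree_of_mem_support_fire he hc)

theorem fireMatrix_pow_mulVec_congr {k : ℕ} {T : RootedSubtree T₀} {f g : RootedSubtree T₀ → ℝ}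
    (h : ∀ U, U.size = max (T.size - k) 1 → f U = g U) :
    (fireMatrix T₀ ^ k *ᵥ f) T = (fireMatrix T₀ ^ k *ᵥ g) T := by
  induction k generalizing T with
  | zero => simpa using h T (max_eq_left T.one_le_size).symm
  | succ k ih =>
    rw [pow_succ', ← mulVec_mulVec, ← mulVec_mulVec]
    refine fireMatrix_mulVec_congr fun V hV => ih fun U hU => h U ?_
    omega

theorem fireMatrix_pow_mulVec_one (k : ℕ) : fireMatrix T₀ ^ k *ᵥ 1 = 1 := by
  induction k with
  | zero => rw [pow_zero, one_mulVec]
  | succ k ih => rw [pow_succ, ← mulVec_mulVec, fireMatrix_mulVec_one, ih]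

theorem Company.remainProb_start (T : RootedSubtree T₀) {k : ℕ} (hk : k ≤ T.size)
    (U : RootedSubtree T₀) : (Company.start T).remainProb k U.verts = (fireMatrix T₀ ^ k) T U := by
  induction k generalizing T with
  | zero =>
    simp only [Company.remainProb_zero, Company.positions_start,
      RootedSubtree.verts_injective.eq_iff, pow_zero, one_apply, eq_comm]
  | succ k ih =>
    calc (Company.start T).remainProb (k + 1) U.verts
        = (fireMatrix T₀ *ᵥ fun V => (Company.start V).remainProb k U.verts) T := by
          rw [Company.remainProb_succ (by rwa [Company.headcount_start]),
            Company.employees_start, fireMatrix_mulVec_apply]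
          refine Finset.expect_congr rfl fun e _ => sum_toReal_apply_mul_congr fun c hc => ?_
          obtain ⟨φ, hφ⟩ := Company.exists_start_tree_eq_comp_of_mem_support_fire hc
          rw [hφ, Company.remainProb_comp]
      _ = (fireMatrix T₀ *ᵥ fun V => (fireMatrix T₀ ^ k) V U) T :=
          fireMatrix_mulVec_congr fun V hV => ih V (by omega)
      _ = (fireMatrix T₀ ^ (k + 1)) T U := by rw [pow_succ']; rfl

theorem toReal_fireUniform_verts (T : RootedSubtree T₀) (k : ℕ) (hk : k ≤ T.size)
    (U : RootedSubtree T₀) : (fireUniform T k hk U.verts).toReal = (fireMatrix T₀ ^ k) T U := by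
  rw [toReal_fireUniform_apply, Company.remainProb_start T hk]

theorem RootedSubtree.exists_size_eq {m : ℕ} (h1 : 1 ≤ m) (hm : m ≤ Fintype.card T₀) :
    ∃ T : RootedSubtree T₀, T.size = m := by
  by_contra! hne
  -- Firing the employees of the full tree one by one, we pass through every size.
  let T : RootedSubtree T₀ :=
    .ofIsLowerSet Finset.univ (by simpa using isLowerSet_univ) (Finset.mem_univ ⊥)
  have hT : T.size = Fintype.card T₀ := Finset.card_univ
  have hzero : (fireMatrix T₀ ^ (Fintype.card T₀ - m) *ᵥ 1) T =
      (fireMatrix T₀ ^ (Fintype.card T₀ - m) *ᵥ 0) T :=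
    fireMatrix_pow_mulVec_congr fun U hU => absurd (hU.trans (by omega)) (hne U)
  rw [fireMatrix_pow_mulVec_one, mulVec_zero] at hzero
  exact one_ne_zero hzero

end Firings

section Transitions

open Matrix

variable {T₀ : RootedTree}

theorem badPerformanceProb_eq {q : ℝ} (hq0 : 0 ≤ q) (hq1 : q ≤ 1) {T : RootedSubtree T₀}
    {S : Finset T₀} (hS : S ⊆ T.verts) :
    badPerformanceProb T q S = (1 - q) ^ S.card * q ^ (T.size - S.card) := by
  classical
  let r : unitInterval := ⟨1 - q, sub_nonneg.mpr hq1, sub_le_self 1 hq0⟩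
  have hset : {x : T.verts → unitInterval | ∀ e : T.verts, (e : T₀) ∈ S ↔ (x e : ℝ) < 1 - q} =
      Set.pi Set.univ fun e : T.verts => if (e : T₀) ∈ S then Set.Iio r else Set.Ici r := by
    ext x
    simp only [Set.mem_ofPred_eq, Set.mem_univ_pi]
    refine forall_congr' fun e => ?_
    split_ifs with h
    · simp [h, r, ← Subtype.coe_lt_coe]
    · simp [h, r, ← Subtype.coe_le_coe]
  have hvol : ∀ e : T.verts,
      (volume (if (e : T₀) ∈ S then Set.Iio r else Set.Ici r)).toReal =
        if (e : T₀) ∈ S then 1 - q else q := fun e => by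
    split_ifs
    · rw [unitInterval.volume_Iio, ENNReal.toReal_ofReal r.2.1]
    · rw [unitInterval.volume_Ici, sub_sub_cancel, ENNReal.toReal_ofReal hq0]
  rw [badPerformanceProb, hset, measureReal_def, volume_pi_pi, ENNReal.toReal_prod]
  simp only [hvol]
  rw [Finset.prod_coe_sort T.verts fun e => if e ∈ S then 1 - q else q, Finset.prod_ite,
    Finset.prod_const, Finset.prod_const, Finset.filter_mem_eq_inter,
    Finset.inter_eq_right.mpr hS, ← Finset.sdiff_eq_filter, Finset.card_sdiff_of_subset hS,
    RootedSubtree.size]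

variable [Fintype T₀]

theorem singleMatrix_mulVec_apply (f : RootedSubtree T₀ → ℝ) (T : RootedSubtree T₀) :
    (singleMatrix T₀ *ᵥ f) T = (T.size : ℝ) / Fintype.card T₀ * (fireMatrix T₀ *ᵥ f) T +
      ((Fintype.card T₀ : ℝ) - T.size) / Fintype.card T₀ * f T := by
  have hrow : singleMatrix T₀ T = ((T.size : ℝ) / Fintype.card T₀) • fireMatrix T₀ T +
      (((Fintype.card T₀ : ℝ) - T.size) / Fintype.card T₀) •
        (1 : Matrix (RootedSubtree T₀) (RootedSubtree T₀) ℝ) T := rfl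
  rw [mulVec, hrow, add_dotProduct, smul_dotProduct, smul_dotProduct]
  change _ + _ • ((1 : Matrix (RootedSubtree T₀) (RootedSubtree T₀) ℝ) *ᵥ f) T = _
  rw [one_mulVec]
  rfl

theorem expect_toReal_fireSet {k : ℕ} {T : RootedSubtree T₀} (hk : k ≤ T.size)
    (U : RootedSubtree T₀) :
    𝔼 S ∈ T.verts.powersetCard k, (fireSet T S U.verts).toReal = (fireMatrix T₀ ^ k) T U := by
  rw [← toReal_fireUniform_verts T k hk, fireUniform, toReal_uniformOfFinset_bind_apply]

theorem binomialMatrix_apply {q : ℝ} (hq0 : 0 ≤ q) (hq1 : q ≤ 1) (T U : RootedSubtree T₀) :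
    binomialMatrix T₀ q T U = ∑ k ∈ Finset.range (T.size + 1),
      (1 - q) ^ k * q ^ (T.size - k) * T.size.choose k * (fireMatrix T₀ ^ k) T U := by
  rw [binomialMatrix, of_apply, Finset.sum_powerset]
  refine Finset.sum_congr rfl fun k hk => ?_
  have hprob : ∀ S ∈ T.verts.powersetCard k,
      badPerformanceProb T q S = (1 - q) ^ k * q ^ (T.size - k) := fun S hS => by
    obtain ⟨hST, rfl⟩ := Finset.mem_powersetCard.mp hS
    exact badPerformanceProb_eq hq0 hq1 hST
  rw [Finset.sum_congr rfl fun S hS => by rw [hprob S hS], ← Finset.mul_sum,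
    ← Finset.card_mul_expect, Finset.card_powersetCard,
    expect_toReal_fireSet (Nat.lt_succ_iff.mp (Finset.mem_range.mp hk)), mul_assoc _ (Nat.cast _)]
  rfl

theorem binomialMatrix_mulVec_apply {q : ℝ} (hq0 : 0 ≤ q) (hq1 : q ≤ 1)
    (f : RootedSubtree T₀ → ℝ) (T : RootedSubtree T₀) :
    (binomialMatrix T₀ q *ᵥ f) T = ∑ k ∈ Finset.range (T.size + 1),
      (1 - q) ^ k * q ^ (T.size - k) * T.size.choose k * (fireMatrix T₀ ^ k *ᵥ f) T := by
  simp only [mulVec, dotProduct, binomialMatrix_apply hq0 hq1, Finset.sum_mul, Finset.mul_sum,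
    mul_assoc]
  exact Finset.sum_comm

variable {f r : RootedSubtree T₀ → ℝ} {w : ℕ}

theorem singleMatrix_mulVec_eq_smul
    (h : ∀ k T, (fireMatrix T₀ ^ k *ᵥ f) T = (T.size - k).choose w * r T) :
    singleMatrix T₀ *ᵥ f = (((Fintype.card T₀ : ℝ) - w) / Fintype.card T₀) • f := by
  funext T
  have hf : f T = T.size.choose w * r T := by simpa using h 0 T
  have hMf : (fireMatrix T₀ *ᵥ f) T = (T.size - 1).choose w * r T := by simpa using h 1 T
  have hchoose : (T.size : ℝ) * (T.size - 1).choose w = (T.size - w) * T.size.choose w := by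
    obtain ⟨n, hn⟩ := Nat.exists_eq_add_of_le' T.one_le_size
    rw [hn, Nat.add_sub_cancel]
    rcases le_or_gt w (n + 1) with hw | hw
    · have hnat : (n + 1) * n.choose w = (n + 1 - w) * (n + 1).choose w := by
        rw [mul_comm, Nat.choose_mul_succ_eq, mul_comm]
      rw [← Nat.cast_sub hw]
      exact_mod_cast hnat
    · rw [Nat.choose_eq_zero_of_lt hw, Nat.choose_eq_zero_of_lt (by omega), Nat.cast_zero,
        mul_zero, mul_zero]
  rw [singleMatrix_mulVec_apply, Pi.smul_apply, smul_eq_mul, hMf, hf]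
  linear_combination r T / Fintype.card T₀ * hchoose

theorem binomialMatrix_mulVec_eq_smul {q : ℝ} (hq0 : 0 ≤ q) (hq1 : q ≤ 1)
    (h : ∀ k T, (fireMatrix T₀ ^ k *ᵥ f) T = (T.size - k).choose w * r T) :
    binomialMatrix T₀ q *ᵥ f = q ^ w • f := by
  funext T
  have hf : f T = T.size.choose w * r T := by simpa using h 0 T
  rw [binomialMatrix_mulVec_apply hq0 hq1, Pi.smul_apply, smul_eq_mul, hf]
  simp only [h, ← mul_assoc]
  rw [← Finset.sum_mul, sum_pow_mul_pow_mul_choose_mul_choose, sub_add_cancel, one_pow, mul_one]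

end Transitions

section Eigenfunctions

open Matrix

variable {T₀ : RootedTree} [Fintype T₀]

theorem subtreeFun_apply (T' T : RootedSubtree T₀) : subtreeFun T' T =
    T.size.choose T'.size * (fireMatrix T₀ ^ (T.size - T'.size)) T T' := by
  rw [subtreeFun, toReal_fireUniform_verts]

theorem subtreeFun_of_size_le {T' T : RootedSubtree T₀} (h : T.size ≤ T'.size) :
    subtreeFun T' T = if T = T' then 1 else 0 := by
  rw [subtreeFun_apply, Nat.sub_eq_zero_of_le h, pow_zero, one_apply]
  split_ifs with hT
  · rw [hT, Nat.choose_self, Nat.cast_one, mul_one]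
  · rw [mul_zero]

theorem fireMatrix_pow_mulVec_subtreeFun {T' : RootedSubtree T₀} (hT' : T'.size ≠ 1) (k : ℕ)
    (T : RootedSubtree T₀) : (fireMatrix T₀ ^ k *ᵥ subtreeFun T') T =
      (T.size - k).choose T'.size * (fireMatrix T₀ ^ (T.size - T'.size)) T T' := by
  have hpos := T'.one_le_size
  rcases le_or_gt T'.size (T.size - k) with hk | hk
  · calc (fireMatrix T₀ ^ k *ᵥ subtreeFun T') T
        = (fireMatrix T₀ ^ k *ᵥ (((T.size - k).choose T'.size : ℝ) •
            fun U => (fireMatrix T₀ ^ (T.size - k - T'.size)) U T')) T :=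
          fireMatrix_pow_mulVec_congr fun U hU => by
            rw [subtreeFun_apply, hU, max_eq_left (hpos.trans hk), Pi.smul_apply, smul_eq_mul]
      _ = (T.size - k).choose T'.size *
            (fireMatrix T₀ ^ k * fireMatrix T₀ ^ (T.size - k - T'.size)) T T' := by
          rw [mulVec_smul]
          rfl
      _ = (T.size - k).choose T'.size * (fireMatrix T₀ ^ (T.size - T'.size)) T T' := by
          rw [← pow_add, show k + (T.size - k - T'.size) = T.size - T'.size by omega]
  · have hzero : (fireMatrix T₀ ^ k *ᵥ subtreeFun T') T = (fireMatrix T₀ ^ k *ᵥ 0) T :=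
      fireMatrix_pow_mulVec_congr fun U hU => by
        rw [subtreeFun_apply, Nat.choose_eq_zero_of_lt (by omega), Nat.cast_zero, zero_mul]
        rfl
    rw [hzero, mulVec_zero, Nat.choose_eq_zero_of_lt hk, Nat.cast_zero, zero_mul]
    rfl

/-- The eigenfunction that belongs to the state `T'`: the function `f_{T'}`, except that the
constant function takes the place of `f_{T'}` if `T'` is the root alone. -/
noncomputable def eigenFun (T' : RootedSubtree T₀) : RootedSubtree T₀ → ℝ :=
  if T'.size = 1 then 1 else subtreeFun T'

/-- The index `j` of the eigenvalue `β_j` of `eigenFun T'`; it is `n₀` for the constant function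
and `n₀ - n'` for `f_{T'}`. -/
noncomputable def eigenIndex (T' : RootedSubtree T₀) : ℕ :=
  if T'.size = 1 then Fintype.card T₀ else Fintype.card T₀ - T'.size

theorem eigenIndex_le_card (T' : RootedSubtree T₀) : eigenIndex T' ≤ Fintype.card T₀ := by
  rw [eigenIndex]
  split_ifs <;> omega

theorem eigenIndex_eq_card_iff {T' : RootedSubtree T₀} :
    eigenIndex T' = Fintype.card T₀ ↔ T' = .single T₀ := by
  have hpos := T'.one_le_size
  have hle := T'.size_le_card
  rw [← RootedSubtree.size_eq_one_iff, eigenIndex]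
  split_ifs <;> omega

theorem eigenIndex_eq_iff {T' : RootedSubtree T₀} {j : ℕ} (hj : j + 2 ≤ Fintype.card T₀) :
    eigenIndex T' = j ↔ T'.size = Fintype.card T₀ - j := by
  have hle := T'.size_le_card
  rw [eigenIndex]
  split_ifs <;> omega

theorem exists_eigenIndex_eq_iff {j : ℕ} : (∃ T' : RootedSubtree T₀, eigenIndex T' = j) ↔
    j + 2 ≤ Fintype.card T₀ ∨ j = Fintype.card T₀ := by
  constructor
  · rintro ⟨T', rfl⟩
    have hpos := T'.one_le_size
    have hle := T'.size_le_card
    rw [eigenIndex]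
    split_ifs <;> omega
  · rintro (hj | rfl)
    · obtain ⟨T', hT'⟩ := RootedSubtree.exists_size_eq (T₀ := T₀) (m := Fintype.card T₀ - j)
        (by omega) (by omega)
      exact ⟨T', (eigenIndex_eq_iff hj).mpr hT'⟩
    · exact ⟨.single T₀, eigenIndex_eq_card_iff.mpr rfl⟩

theorem card_filter_eigenIndex_eq_card :
    (Finset.univ.filter fun T' : RootedSubtree T₀ => eigenIndex T' = Fintype.card T₀).card = 1 := by
  simp only [eigenIndex_eq_card_iff, Finset.filter_eq', Finset.mem_univ, if_true,
    Finset.card_singleton]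

theorem card_filter_eigenIndex_eq {j : ℕ} (hj : j + 2 ≤ Fintype.card T₀) :
    (Finset.univ.filter fun T' : RootedSubtree T₀ => eigenIndex T' = j).card =
      numSubtrees T₀ (Fintype.card T₀ - j) := by
  simp only [eigenIndex_eq_iff hj, numSubtrees]

theorem prod_eigenIndex {M : Type*} [CommMonoid M] (F : ℕ → M) :
    ∏ T' : RootedSubtree T₀, F (eigenIndex T') = F (Fintype.card T₀) *
      ∏ j ∈ Finset.range (Fintype.card T₀ - 1), F j ^ numSubtrees T₀ (Fintype.card T₀ - j) := by
  have hmaps : ∀ T' ∈ (Finset.univ : Finset (RootedSubtree T₀)), eigenIndex T' ∈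
      insert (Fintype.card T₀) (Finset.range (Fintype.card T₀ - 1)) := fun T' _ => by
    have := exists_eigenIndex_eq_iff.mp ⟨T', rfl⟩
    rw [Finset.mem_insert, Finset.mem_range]
    omega
  rw [← Finset.prod_fiberwise_of_maps_to' hmaps, Finset.prod_insert (by simp), Finset.prod_const,
    card_filter_eigenIndex_eq_card, pow_one]
  refine congrArg _ (Finset.prod_congr rfl fun j hj => ?_)
  rw [Finset.mem_range] at hj
  rw [Finset.prod_const, card_filter_eigenIndex_eq (by omega)]

theorem exists_fireMatrix_pow_mulVec_eigenFun (T' : RootedSubtree T₀) :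
    ∃ r : RootedSubtree T₀ → ℝ, ∀ k T, (fireMatrix T₀ ^ k *ᵥ eigenFun T') T =
      (T.size - k).choose (Fintype.card T₀ - eigenIndex T') * r T := by
  by_cases hT' : T'.size = 1
  · refine ⟨1, fun k T => ?_⟩
    rw [eigenFun, eigenIndex, if_pos hT', if_pos hT', fireMatrix_pow_mulVec_one, Nat.sub_self,
      Nat.choose_zero_right, Nat.cast_one, one_mul]
  · refine ⟨fun T => (fireMatrix T₀ ^ (T.size - T'.size)) T T', fun k T => ?_⟩
    rw [eigenFun, eigenIndex, if_neg hT', if_neg hT', fireMatrix_pow_mulVec_subtreeFun hT',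
      Nat.sub_sub_self T'.size_le_card]

theorem eigenFun_self (T' : RootedSubtree T₀) : eigenFun T' T' = 1 := by
  rw [eigenFun]
  split_ifs
  · rfl
  · rw [subtreeFun_of_size_le le_rfl, if_pos rfl]

theorem eigenFun_eq_zero {T' T : RootedSubtree T₀} (hne : T' ≠ T) (h : T.size ≤ T'.size) :
    eigenFun T' T = 0 := by
  have hT' : T'.size ≠ 1 := fun h1 => hne <| by
    have hT : T.size = 1 := le_antisymm (h1 ▸ h) T.one_le_size
    rw [RootedSubtree.size_eq_one_iff.mp h1, RootedSubtree.size_eq_one_iff.mp hT]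
  rw [eigenFun, if_neg hT', subtreeFun_of_size_le h, if_neg hne.symm]

/-- The basis of the common eigenfunctions of the two chains. -/
noncomputable def eigenBasis (T₀ : RootedTree) [Fintype T₀] :
    Module.Basis (RootedSubtree T₀) ℝ (RootedSubtree T₀ → ℝ) :=
  basisOfLinearIndependentOfCardEqFinrank' eigenFun
    (linearIndependent_of_triangular RootedSubtree.size
      (fun T' => (eigenFun_self T').trans_ne one_ne_zero) fun _ _ => eigenFun_eq_zero)
    (Module.finrank_fintype_fun_eq_card ℝ).symm

theorem eigenBasis_apply (T' : RootedSubtree T₀) : eigenBasis T₀ T' = eigenFun T' := by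
  rw [eigenBasis, coe_basisOfLinearIndependentOfCardEqFinrank']

end Eigenfunctions

section Spectrum

open Matrix Polynomial

variable {T₀ : RootedTree} [Fintype T₀]

/-- The matrix `K` is diagonal in the basis of the functions `eigenFun T'`, with the eigenvalue
`β j` on the functions of index `j` and the eigenvalue `1` on the constant function. -/
structure ActsDiagonally (K : Matrix (RootedSubtree T₀) (RootedSubtree T₀) ℝ) (β : ℕ → ℝ) :
    Prop where
  mulVec_eigenFun : ∀ T', K *ᵥ eigenFun T' = β (eigenIndex T') • eigenFun T'
  eigenvalue_card : β (Fintype.card T₀) = 1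

theorem cast_card_ne_zero : (Fintype.card T₀ : ℝ) ≠ 0 :=
  have : Nonempty T₀ := ⟨⊥⟩
  Nat.cast_ne_zero.mpr Fintype.card_ne_zero

theorem actsDiagonally_singleMatrix :
    ActsDiagonally (singleMatrix T₀) fun j => j / Fintype.card T₀ where
  mulVec_eigenFun T' := by
    obtain ⟨r, hr⟩ := exists_fireMatrix_pow_mulVec_eigenFun T'
    rw [singleMatrix_mulVec_eq_smul hr, Nat.cast_sub (eigenIndex_le_card T'), sub_sub_cancel]
  eigenvalue_card := div_self cast_card_ne_zero

theorem actsDiagonally_binomialMatrix {q : ℝ} (hq0 : 0 ≤ q) (hq1 : q ≤ 1) :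
    ActsDiagonally (binomialMatrix T₀ q) fun j => q ^ (Fintype.card T₀ - j) where
  mulVec_eigenFun T' := by
    obtain ⟨r, hr⟩ := exists_fireMatrix_pow_mulVec_eigenFun T'
    exact binomialMatrix_mulVec_eq_smul hq0 hq1 hr
  eigenvalue_card := by rw [Nat.sub_self, pow_zero]

theorem div_card_inj {i j : ℕ} :
    (i : ℝ) / Fintype.card T₀ = j / Fintype.card T₀ ↔ i = j := by
  rw [div_left_inj' cast_card_ne_zero, Nat.cast_inj]

namespace ActsDiagonally

variable {K : Matrix (RootedSubtree T₀) (RootedSubtree T₀) ℝ} {β : ℕ → ℝ}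

theorem toLin'_eigenBasis (h : ActsDiagonally K β) (T' : RootedSubtree T₀) :
    toLin' K (eigenBasis T₀ T') = β (eigenIndex T') • eigenBasis T₀ T' := by
  rw [toLin'_apply, eigenBasis_apply, h.mulVec_eigenFun]

theorem hasEigenvalue_iff (h : ActsDiagonally K β) (μ : ℝ) :
    Module.End.HasEigenvalue (toLin' K) μ ↔
      ∃ j : ℕ, (j + 2 ≤ Fintype.card T₀ ∨ j = Fintype.card T₀) ∧ μ = β j := by
  rw [eq_toLin_diagonal h.toLin'_eigenBasis, hasEigenvalue_toLin_diagonal_iff]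
  simp only [← exists_eigenIndex_eq_iff]
  constructor
  · rintro ⟨T', rfl⟩
    exact ⟨_, ⟨T', rfl⟩, rfl⟩
  · rintro ⟨_, ⟨T', rfl⟩, rfl⟩
    exact ⟨T', rfl⟩

theorem charpoly_eq_prod (h : ActsDiagonally K β) :
    K.charpoly = ∏ T' : RootedSubtree T₀, (X - C (β (eigenIndex T'))) := by
  rw [← charpoly_toLin', charpoly_eq_prod_of_apply_basis h.toLin'_eigenBasis]

theorem charpoly_eq (h : ActsDiagonally K β) :
    K.charpoly = (X - C 1) * ∏ j ∈ Finset.range (Fintype.card T₀ - 1),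
      (X - C (β j)) ^ numSubtrees T₀ (Fintype.card T₀ - j) := by
  rw [h.charpoly_eq_prod, prod_eigenIndex fun j => X - C (β j), h.eigenvalue_card]

theorem multiplicity_eq_card (h : ActsDiagonally K β) {j : ℕ}
    (hβ : ∀ i ≤ Fintype.card T₀, β i = β j ↔ i = j) :
    K.charpoly.rootMultiplicity (β j) =
        (Finset.univ.filter fun T' : RootedSubtree T₀ => eigenIndex T' = j).card ∧
      Module.finrank ℝ (Module.End.eigenspace (toLin' K) (β j)) =
        (Finset.univ.filter fun T' : RootedSubtree T₀ => eigenIndex T' = j).card := by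
  rw [finrank_eigenspace_eq_rootMultiplicity h.toLin'_eigenBasis, charpoly_toLin',
    h.charpoly_eq_prod, rootMultiplicity_prod_X_sub_C, and_self]
  simp only [hβ _ (eigenIndex_le_card _)]

theorem multiplicity_one (h : ActsDiagonally K β)
    (hβ : ∀ i ≤ Fintype.card T₀, β i = 1 ↔ i = Fintype.card T₀) :
    K.charpoly.rootMultiplicity 1 = 1 ∧
      Module.finrank ℝ (Module.End.eigenspace (toLin' K) 1) = 1 := by
  have hmul := h.multiplicity_eq_card (j := Fintype.card T₀) (by rwa [h.eigenvalue_card])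
  rwa [card_filter_eigenIndex_eq_card, h.eigenvalue_card] at hmul

theorem multiplicity_eq_numSubtrees (h : ActsDiagonally K β) {j : ℕ}
    (hj : j + 2 ≤ Fintype.card T₀) (hβ : ∀ i ≤ Fintype.card T₀, β i = β j ↔ i = j) :
    K.charpoly.rootMultiplicity (β j) = numSubtrees T₀ (Fintype.card T₀ - j) ∧
      Module.finrank ℝ (Module.End.eigenspace (toLin' K) (β j)) =
        numSubtrees T₀ (Fintype.card T₀ - j) :=
  card_filter_eigenIndex_eq hj ▸ h.multiplicity_eq_card hβ

theorem hasEigenvector_eigenFun (h : ActsDiagonally K β) (T' : RootedSubtree T₀) :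
    Module.End.HasEigenvector (toLin' K) (β (eigenIndex T')) (eigenFun T') :=
  eigenBasis_apply T' ▸
    ⟨Module.End.mem_eigenspace_iff.mpr (h.toLin'_eigenBasis T'), (eigenBasis T₀).ne_zero T'⟩

theorem hasEigenvector_one (h : ActsDiagonally K β) :
    Module.End.HasEigenvector (toLin' K) 1 fun _ => 1 := by
  have hsize : (RootedSubtree.single T₀).size = 1 := RootedSubtree.size_eq_one_iff.mpr rfl
  have heig := h.hasEigenvector_eigenFun (.single T₀)
  rwa [eigenIndex, eigenFun, if_pos hsize, if_pos hsize, h.eigenvalue_card] at heig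

theorem hasEigenvector_subtreeFun (h : ActsDiagonally K β) {T' : RootedSubtree T₀}
    (hT' : T'.size ≠ 1) :
    Module.End.HasEigenvector (toLin' K) (β (Fintype.card T₀ - T'.size)) (subtreeFun T') := by
  have heig := h.hasEigenvector_eigenFun T'
  rwa [eigenIndex, eigenFun, if_neg hT', if_neg hT'] at heig

end ActsDiagonally

end Spectrum

end EmployeeFiring

open EmployeeFiring Polynomial in
theorem theorem5p3 (T₀ : RootedTree) [Fintype T₀] (n₀ : ℕ) (hn₀ : Fintype.card T₀ = n₀)
    (q : ℝ) (hq0 : 0 ≤ q) (hq1 : q ≤ 1) :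
    -- the eigenvalues
    (∀ β : ℝ, Module.End.HasEigenvalue (Matrix.toLin' (singleMatrix T₀)) β ↔
      ∃ j : ℕ, (j + 2 ≤ n₀ ∨ j = n₀) ∧ β = (j : ℝ) / n₀) ∧
    (∀ β : ℝ, Module.End.HasEigenvalue (Matrix.toLin' (binomialMatrix T₀ q)) β ↔
      ∃ j : ℕ, (j + 2 ≤ n₀ ∨ j = n₀) ∧ β = q ^ (n₀ - j)) ∧
    -- the eigenvalues counted with multiplicity
    (singleMatrix T₀).charpoly = (X - C 1) *
      ∏ j ∈ Finset.range (n₀ - 1), (X - C ((j : ℝ) / n₀)) ^ numSubtrees T₀ (n₀ - j) ∧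
    (binomialMatrix T₀ q).charpoly = (X - C 1) *
      ∏ j ∈ Finset.range (n₀ - 1), (X - C (q ^ (n₀ - j))) ^ numSubtrees T₀ (n₀ - j) ∧
    -- algebraic and geometric multiplicities of the single eigenvalues
    ((singleMatrix T₀).charpoly.rootMultiplicity 1 = 1 ∧
      Module.finrank ℝ (Module.End.eigenspace (Matrix.toLin' (singleMatrix T₀)) 1) = 1) ∧
    (∀ j : ℕ, j + 2 ≤ n₀ →
      (singleMatrix T₀).charpoly.rootMultiplicity ((j : ℝ) / n₀) = numSubtrees T₀ (n₀ - j) ∧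
      Module.finrank ℝ (Module.End.eigenspace (Matrix.toLin' (singleMatrix T₀)) ((j : ℝ) / n₀)) =
        numSubtrees T₀ (n₀ - j)) ∧
    (q < 1 →
      (binomialMatrix T₀ q).charpoly.rootMultiplicity 1 = 1 ∧
      Module.finrank ℝ (Module.End.eigenspace (Matrix.toLin' (binomialMatrix T₀ q)) 1) = 1) ∧
    (0 < q → q < 1 → ∀ j : ℕ, j + 2 ≤ n₀ →
      (binomialMatrix T₀ q).charpoly.rootMultiplicity (q ^ (n₀ - j)) = numSubtrees T₀ (n₀ - j) ∧
      Module.finrank ℝ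
          (Module.End.eigenspace (Matrix.toLin' (binomialMatrix T₀ q)) (q ^ (n₀ - j))) =
        numSubtrees T₀ (n₀ - j)) ∧
    -- the right eigenfunctions
    (∀ T' : RootedSubtree T₀, T'.size ≠ 1 →
      Module.End.HasEigenvector (Matrix.toLin' (singleMatrix T₀))
        (((n₀ : ℝ) - T'.size) / n₀) (subtreeFun T') ∧
      Module.End.HasEigenvector (Matrix.toLin' (binomialMatrix T₀ q))
        (q ^ T'.size) (subtreeFun T')) ∧
    Module.End.HasEigenvector (Matrix.toLin' (singleMatrix T₀)) 1 (fun _ => 1) ∧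
    Module.End.HasEigenvector (Matrix.toLin' (binomialMatrix T₀ q)) 1 (fun _ => 1) ∧
    -- the functions `subtreeFun T'` and the constant function form a basis
    (∃ b : Module.Basis (RootedSubtree T₀) ℝ (RootedSubtree T₀ → ℝ),
      ∀ T' : RootedSubtree T₀, b T' = if T'.size = 1 then (fun _ => 1) else subtreeFun T') := by
  subst hn₀
  have hs := actsDiagonally_singleMatrix (T₀ := T₀)
  have hb := actsDiagonally_binomialMatrix (T₀ := T₀) hq0 hq1
  refine ⟨hs.hasEigenvalue_iff, hb.hasEigenvalue_iff, hs.charpoly_eq, hb.charpoly_eq,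
    hs.multiplicity_one fun i _ => hs.eigenvalue_card ▸ div_card_inj,
    fun j hj => hs.multiplicity_eq_numSubtrees hj fun i _ => div_card_inj,
    fun hq => hb.multiplicity_one fun i => pow_tsub_eq_one_iff hq0 hq,
    fun hq hq' j hj => hb.multiplicity_eq_numSubtrees hj fun i hi =>
      pow_tsub_inj hq hq' hi (by omega),
    fun T' hT' => ⟨?_, ?_⟩, hs.hasEigenvector_one, hb.hasEigenvector_one,
    eigenBasis T₀, eigenBasis_apply⟩
  · rw [← Nat.cast_sub T'.size_le_card]
    exact hs.hasEigenvector_subtreeFun hT'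
  · simpa only [Nat.sub_sub_self T'.size_le_card] using hb.hasEigenvector_subtreeFun hT'
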